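/- Let $\Omega\subset\mathbb R^n$ be a bounded Borel set, let $\lambda$ denote Lebesgue measure, and let $F\subset\overline\Omega$ be closed such that $\lambda(B(x,\delta)\cap\Omega)>0$ for all $x\in F$ and $\delta>0$. Let $\mathrm{ba}$ be the vector lattice of all bounded finitely additive set functions $\mu:\mathcal B(\Omega)\to\mathbb R$ on the Borel subsets of $\Omega$, ordered by $\mu\le\nu$ iff $\mu(A)\le\nu(A)$ for all $A$, with $|\mu|=\sup\{\mu,0\}+\sup\{-\mu,0\}$. Let $\mathrm{ba}_w(\lambda)$ be the set of $\mu\in\mathrm{ba}$ with $\mu(A)=0$ whenever $\lambda(A)=0$, and let $\mathrm{ca}$ be the set of $\sigma$-additive $\nu\in\mathrm{ba}$. The core of $\mu\in\mathrm{ba}$ is $$\operatorname{core}\mu=\{x\in\mathbb R^n:\ |\mu|(U\cap\Omega)>0\ \text{for every open } U\subset\mathbb R^n \text{ with } x\in U\},$$ and $\mu$ is called pure if $\inf\{|\mu|,|\nu|\}=0$ in $\mathrm{ba}$ for every $\nu\in\mathrm{ca}$. A function $f:\Omega\to\mathbb R$ is $\mu$-integrable if there are simple Borel functions $h_k:\Omega\to\mathbb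 R$ that converge to $f$ in measure, i.e. $\inf\{|\mu|(A): A\in\mathcal B(\Omega),\ A\supset\{|h_k-f|>\varepsilon\}\}\to0$ as $k\to\infty$ for every $\varepsilon>0$, and that satisfy $\int_\Omega|h_k-h_l|\,d|\mu|\to0$ as $k,l\to\infty$; then $\int_\Omega f\,d\mu:=\lim_k\int_\Omega h_k\,d\mu$. Let $\sigma$ be a (finite, signed) Radon measure on $F$. Then there exists $\mu\in\mathrm{ba}_w(\lambda)$ such that every $\varphi\in C(\overline\Omega)$ is $\mu$-integrable on $\Omega$ with $$\int_\Omega\varphi\,d\mu=\int_F\varphi\,d\sigma,$$ and such that $\operatorname{core}\mu\subset F$ and $|\mu|(\Omega)=|\sigma|(F)$. If, in addition, $\lambda(F\cap\Omega)=0$, then $\mu$ is pure. -/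

import Mathlib

open MeasureTheory Filter Topology Set

/-- A bounded, finitely additive real-valued set function on the measurable subsets of `X`,
extended by the value `0` to the non-measurable sets (so that two of them are equal if and only
if they agree on all measurable sets). -/
structure BoundedCharge (X : Type*) [MeasurableSpace X] where
  toFun : Set X → ℝ
  not_measurable' : ∀ A, ¬ MeasurableSet A → toFun A = 0
  union' : ∀ A B, MeasurableSet A → MeasurableSet B → Disjoint A B →
    toFun (A ∪ B) = toFun A + toFun B
  bounded' : ∃ C : ℝ, ∀ A, |toFun A| ≤ C

namespace BoundedCharge

variable {X : Type*} [MeasurableSpace X]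

instance : CoeFun (BoundedCharge X) (fun _ => Set X → ℝ) := ⟨toFun⟩

theorem ext_set {μ ν : BoundedCharge X} (h : ∀ A, MeasurableSet A → μ A = ν A) : μ = ν := by
  have : μ.toFun = ν.toFun := by
    funext A
    by_cases hA : MeasurableSet A
    · exact h A hA
    · rw [μ.not_measurable' A hA, ν.not_measurable' A hA]
  cases μ; cases ν; cases this; rfl

theorem apply_empty (μ : BoundedCharge X) : μ ∅ = 0 := by
  have h := μ.union' ∅ ∅ .empty .empty (disjoint_empty _)
  rw [union_empty] at h
  linarith

/-! ### The ordered vector group structure (setwise operations and setwise order) -/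

instance : Zero (BoundedCharge X) :=
  ⟨⟨fun _ => 0, fun _ _ => rfl, fun _ _ _ _ _ => by simp, ⟨0, fun _ => by simp⟩⟩⟩

instance : Add (BoundedCharge X) :=
  ⟨fun μ ν => ⟨fun A => μ A + ν A,
    fun A hA => by rw [μ.not_measurable' A hA, ν.not_measurable' A hA, add_zero],
    fun A B hA hB h => by rw [μ.union' A B hA hB h, ν.union' A B hA hB h]; ring,
    by
      obtain ⟨C, hC⟩ := μ.bounded'
      obtain ⟨D, hD⟩ := ν.bounded'
      exact ⟨C + D, fun A => (abs_add_le _ _).trans (add_le_add (hC A) (hD A))⟩⟩⟩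

instance : Neg (BoundedCharge X) :=
  ⟨fun μ => ⟨fun A => - μ A,
    fun A hA => by rw [μ.not_measurable' A hA, neg_zero],
    fun A B hA hB h => by rw [μ.union' A B hA hB h]; ring,
    by
      obtain ⟨C, hC⟩ := μ.bounded'
      exact ⟨C, fun A => by rw [abs_neg]; exact hC A⟩⟩⟩

theorem zero_apply (A : Set X) : (0 : BoundedCharge X) A = 0 := rfl

theorem add_apply (μ ν : BoundedCharge X) (A : Set X) : (μ + ν) A = μ A + ν A := rfl

theorem neg_apply (μ : BoundedCharge X) (A : Set X) : (-μ) A = - μ A := rfl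

instance : AddCommGroup (BoundedCharge X) where
  add_assoc μ ν ρ := ext_set fun A _ => add_assoc (μ A) (ν A) (ρ A)
  zero_add μ := ext_set fun A _ => zero_add (μ A)
  add_zero μ := ext_set fun A _ => add_zero (μ A)
  neg_add_cancel μ := ext_set fun A _ => neg_add_cancel (μ A)
  add_comm μ ν := ext_set fun A _ => add_comm (μ A) (ν A)
  nsmul := nsmulRec
  zsmul := zsmulRec

theorem sub_apply (μ ν : BoundedCharge X) (A : Set X) : (μ - ν) A = μ A - ν A := by
  rw [sub_eq_add_neg, add_apply, neg_apply, sub_eq_add_neg]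

instance : PartialOrder (BoundedCharge X) where
  le μ ν := ∀ A, MeasurableSet A → μ A ≤ ν A
  le_refl _ _ _ := le_rfl
  le_trans _ _ _ h h' A hA := (h A hA).trans (h' A hA)
  le_antisymm _ _ h h' := ext_set fun A hA => le_antisymm (h A hA) (h' A hA)

theorem le_def {μ ν : BoundedCharge X} : μ ≤ ν ↔ ∀ A, MeasurableSet A → μ A ≤ ν A := Iff.rfl

instance : IsOrderedAddMonoid (BoundedCharge X) where
  add_le_add_left _ _ h ρ A hA := by
    simpa only [add_apply] using add_le_add_left (h A hA) (ρ A)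

/-! ### The lattice structure -/

/-- The values of `μ` on the measurable subsets of `A`. -/
def subValues (μ : BoundedCharge X) (A : Set X) : Set ℝ :=
  {r | ∃ B, MeasurableSet B ∧ B ⊆ A ∧ μ B = r}

theorem subValues_nonempty (μ : BoundedCharge X) (A : Set X) : (μ.subValues A).Nonempty :=
  ⟨μ ∅, ∅, .empty, empty_subset _, rfl⟩

theorem subValues_bddAbove (μ : BoundedCharge X) (A : Set X) : BddAbove (μ.subValues A) := by
  obtain ⟨C, hC⟩ := μ.bounded'
  refine ⟨C, ?_⟩
  rintro _ ⟨B, -, -, rfl⟩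
  exact (le_abs_self _).trans (hC B)

open Classical in
/-- `(sup {μ, 0})(A) = sup {μ(B) : B ⊆ A measurable}`. -/
noncomputable def supZero (μ : BoundedCharge X) : BoundedCharge X where
  toFun A := if MeasurableSet A then sSup (μ.subValues A) else 0
  not_measurable' A hA := if_neg hA
  union' A B hA hB h := by
    rw [if_pos hA, if_pos hB, if_pos (hA.union hB)]
    apply le_antisymm
    · apply csSup_le (μ.subValues_nonempty _)
      rintro _ ⟨D, hD, hDs, rfl⟩
      have h1 : μ D = μ (D ∩ A) + μ (D ∩ B) := by
        rw [← μ.union' _ _ (hD.inter hA) (hD.inter hB)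
          (h.mono inter_subset_right inter_subset_right), ← inter_union_distrib_left,
          inter_eq_left.2 hDs]
      rw [h1]
      exact add_le_add
        (le_csSup (μ.subValues_bddAbove _) ⟨_, hD.inter hA, inter_subset_right, rfl⟩)
        (le_csSup (μ.subValues_bddAbove _) ⟨_, hD.inter hB, inter_subset_right, rfl⟩)
    · rw [← le_sub_iff_add_le]
      apply csSup_le (μ.subValues_nonempty _)
      rintro _ ⟨D, hD, hDs, rfl⟩
      rw [le_sub_comm]
      apply csSup_le (μ.subValues_nonempty _)
      rintro _ ⟨D', hD', hDs', rfl⟩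
      rw [le_sub_iff_add_le, add_comm, ← μ.union' _ _ hD hD' (h.mono hDs hDs')]
      exact le_csSup (μ.subValues_bddAbove _)
        ⟨_, hD.union hD', union_subset_union hDs hDs', rfl⟩
  bounded' := by
    obtain ⟨C, hC⟩ := μ.bounded'
    have hC0 : 0 ≤ C := (abs_nonneg _).trans (hC ∅)
    refine ⟨C, fun A => ?_⟩
    split_ifs with hA
    · refine abs_le.2 ⟨?_, ?_⟩
      · have : (0 : ℝ) ≤ sSup (μ.subValues A) :=
          le_csSup (μ.subValues_bddAbove _) ⟨∅, .empty, empty_subset _, μ.apply_empty⟩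
        linarith
      · apply csSup_le (μ.subValues_nonempty _)
        rintro _ ⟨D, -, -, rfl⟩
        exact (le_abs_self _).trans (hC D)
    · simpa using hC0

theorem supZero_apply (μ : BoundedCharge X) {A : Set X} (hA : MeasurableSet A) :
    μ.supZero A = sSup (μ.subValues A) := if_pos hA

theorem le_supZero (μ : BoundedCharge X) : μ ≤ μ.supZero := fun A hA => by
  rw [supZero_apply μ hA]
  exact le_csSup (μ.subValues_bddAbove _) ⟨A, hA, Subset.rfl, rfl⟩

theorem supZero_nonneg (μ : BoundedCharge X) : 0 ≤ μ.supZero := fun A hA => by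
  rw [supZero_apply μ hA, zero_apply]
  exact le_csSup (μ.subValues_bddAbove _) ⟨∅, .empty, empty_subset _, μ.apply_empty⟩

theorem supZero_le {μ ν : BoundedCharge X} (h : μ ≤ ν) (h0 : 0 ≤ ν) : μ.supZero ≤ ν := by
  intro A hA
  rw [supZero_apply μ hA]
  apply csSup_le (μ.subValues_nonempty _)
  rintro _ ⟨B, hB, hBA, rfl⟩
  have h1 := ν.union' B (A \ B) hB (hA.diff hB) disjoint_sdiff_right
  rw [union_sdiff_cancel hBA] at h1
  have h2 := h B hB
  have h3 : 0 ≤ ν (A \ B) := h0 _ (hA.diff hB)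
  linarith

/-- Supremum and infimum with respect to the setwise order. In particular `|μ| = μ ⊔ -μ` is the
total variation of `μ`, which is also the sum of `μ⁺ = μ ⊔ 0` and `μ⁻ = -μ ⊔ 0`. -/
noncomputable instance : Lattice (BoundedCharge X) where
  sup μ ν := (μ - ν).supZero + ν
  le_sup_left μ ν := by
    have := le_supZero (μ - ν)
    exact sub_le_iff_le_add.1 this
  le_sup_right μ ν := le_add_of_nonneg_left (supZero_nonneg (μ - ν))
  sup_le μ ν ρ h h' := by
    rw [← le_sub_iff_add_le]
    exact supZero_le (sub_le_sub_right h ν) (sub_nonneg.2 h')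
  inf μ ν := μ - (μ - ν).supZero
  inf_le_left μ ν := sub_le_self _ (supZero_nonneg (μ - ν))
  inf_le_right μ ν := sub_le_comm.1 (le_supZero (μ - ν))
  le_inf ρ μ ν h h' := by
    rw [le_sub_comm]
    exact supZero_le (sub_le_sub_left h' μ) (sub_nonneg.2 h)

/-! ### Weak absolute continuity, σ-additivity, pure charges -/

/-- `ba_w(m)`: the bounded charges that vanish on the measurable null sets of `m`. -/
def baW (m : Measure X) : Set (BoundedCharge X) :=
  {μ | ∀ A, MeasurableSet A → m A = 0 → μ A = 0}

/-- `ca`: the σ-additive bounded charges. -/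
def ca (X : Type*) [MeasurableSpace X] : Set (BoundedCharge X) :=
  {μ | ∀ A : ℕ → Set X, (∀ i, MeasurableSet (A i)) → Pairwise (fun i j => Disjoint (A i) (A j)) →
    HasSum (fun i => μ (A i)) (μ (⋃ i, A i))}

/-- A bounded charge is pure if it lies in the orthogonal complement of `ca`, where `μ ⊥ ν`
means `|μ| ∧ |ν| = 0`. -/
def IsPure (μ : BoundedCharge X) : Prop :=
  ∀ ν ∈ ca X, |μ| ⊓ |ν| = 0

/-! ### Integration with respect to a bounded charge -/

/-- The outer charge of a (nonnegative) bounded charge. -/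
noncomputable def outer (ν : BoundedCharge X) (B : Set X) : ℝ :=
  sInf {r | ∃ A, MeasurableSet A ∧ B ⊆ A ∧ ν A = r}

/-- Convergence in `μ`-measure. -/
def ConvergesInMeasure (μ : BoundedCharge X) (f : ℕ → X → ℝ) (g : X → ℝ) : Prop :=
  ∀ ε : ℝ, 0 < ε → Tendsto (fun k => outer |μ| {x | ε < |f k x - g x|}) atTop (𝓝 0)

/-- The integral of a simple function. -/
noncomputable def simpleIntegral (μ : BoundedCharge X) (s : SimpleFunc X ℝ) : ℝ :=
  ∑ c ∈ s.range, c * μ (s ⁻¹' {c})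

/-- `f` is `μ`-integrable with integral `I`: there is a sequence of simple functions that converges
to `f` in `μ`-measure, is Cauchy in `L¹(|μ|)`, and whose integrals converge to `I`. -/
def HasIntegral (μ : BoundedCharge X) (f : X → ℝ) (I : ℝ) : Prop :=
  ∃ s : ℕ → SimpleFunc X ℝ,
    ConvergesInMeasure μ (fun k => s k) f ∧
    Tendsto (fun p : ℕ × ℕ => simpleIntegral |μ| ((s p.1 - s p.2).map fun t => |t|))
      atTop (𝓝 0) ∧
    Tendsto (fun k => simpleIntegral μ (s k)) atTop (𝓝 I)

/-! ### The core -/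

/-- The core of a bounded charge on the Borel subsets of `Ω ⊆ E`: a set of points of the ambient
space `E`, not necessarily of `Ω`. -/
def core {E : Type*} [TopologicalSpace E] [MeasurableSpace E] {Ω : Set E}
    (μ : BoundedCharge Ω) : Set E :=
  {x | ∀ U : Set E, IsOpen U → x ∈ U → 0 < |μ| (Subtype.val ⁻¹' U : Set Ω)}

end BoundedCharge

/-- The integral with respect to a finite signed measure, through its Jordan decomposition. -/
noncomputable def signedIntegral {Y : Type*} [MeasurableSpace Y] (σ : SignedMeasure Y)
    (f : Y → ℝ) : ℝ :=
  ∫ y, f y ∂σ.toJordanDecomposition.posPart - ∫ y, f y ∂σ.toJordanDecomposition.negPart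

/-! ### Setwise limits of measures and integration against charges -/

namespace BoundedCharge

variable {X : Type*} [MeasurableSpace X]

/-! Smear each Dirac mass at `x ∈ F` over `B(x, r) ∩ Ω` by normalized Lebesgue measure, which is
possible because that set has positive measure. Averaging against a positive measure `ν` on `F`
gives a λ-continuous measure on `Ω` with the mass of `ν`. As `r → 0`, its integrals of a continuous
`φ` tend to `∫ φ dν`, by uniform continuity on the compact closure of `Ω`. A setwise limit along an
ultrafilter keeps finite additivity, null sets and total mass, though perhaps not σ-additivity
(`exists_charge_of_measure`).

Let `P`, `N` be the limits for the Jordan parts of `σ`, and `μ = P - N`. All of `P + N` sits on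
every thickening of `F`, which locates the core. Since `|μ| ≤ P + N`, the variation is at most that
of `σ`; equality comes from disjoint neighbourhoods of compact sets that nearly carry the two Jordan
parts. If `F ∩ Ω` is null, `μ` is concentrated on thickenings with `F` removed; these decrease to
the empty set, so a σ-additive charge sees nothing of `μ` (`isPure_of_antitone`). -/

theorem mono_of_nonneg {ν : BoundedCharge X} (h : 0 ≤ ν) {A B : Set X} (hA : MeasurableSet A)
    (hB : MeasurableSet B) (hAB : A ⊆ B) : ν A ≤ ν B := by
  have h1 := ν.union' A (B \ A) hA (hB.diff hA) disjoint_sdiff_right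
  rw [union_sdiff_cancel hAB] at h1
  have h2 : 0 ≤ ν (B \ A) := h _ (hB.diff hA)
  linarith

theorem apply_le_abs (μ : BoundedCharge X) {A : Set X} (hA : MeasurableSet A) :
    μ A ≤ |μ| A := le_abs_self μ A hA

theorem neg_apply_le_abs (μ : BoundedCharge X) {A : Set X} (hA : MeasurableSet A) :
    -μ A ≤ |μ| A := neg_le_abs μ A hA

/-- The charge defined by a finite measure. -/
noncomputable def ofMeasure (m : Measure X) [IsFiniteMeasure m] : BoundedCharge X := by
  classical
  exact
  { toFun := fun A => if MeasurableSet A then m.real A else 0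
    not_measurable' := fun A hA => if_neg hA
    union' := fun A B hA hB h => by
      rw [if_pos hA, if_pos hB, if_pos (hA.union hB), measureReal_union h hB]
    bounded' := ⟨m.real univ, fun A => by
      split_ifs
      · rw [abs_of_nonneg measureReal_nonneg]
        exact measureReal_mono (subset_univ A)
      · simp⟩ }

theorem ofMeasure_apply (m : Measure X) [IsFiniteMeasure m] {A : Set X} (hA : MeasurableSet A) :
    ofMeasure m A = m.real A := if_pos hA

/-- Bounded sequences of measures have setwise limits along ultrafilters, which are charges. -/
theorem exists_ultralimit (U : Ultrafilter ℕ) (m : ℕ → Measure X) [∀ k, IsFiniteMeasure (m k)]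
    (C : ℝ) (hC : ∀ k, (m k).real univ ≤ C) :
    ∃ μ : BoundedCharge X, ∀ A, MeasurableSet A →
      Tendsto (fun k => (m k).real A) U (𝓝 (μ A)) := by
  classical
  have hb : ∀ A k, (m k).real A ∈ Icc 0 C := fun A k =>
    ⟨measureReal_nonneg, (measureReal_mono (subset_univ A)).trans (hC k)⟩
  have hlim : ∀ A : Set X, ∃ L ∈ Icc 0 C, Tendsto (fun k => (m k).real A) U (𝓝 L) := by
    intro A
    -- The image ultrafilter contains a compact interval, hence converges; no subsequence has to
    -- serve all sets at once.
    exact (isCompact_Icc (a := (0 : ℝ)) (b := C)).ultrafilter_le_nhds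
      (U.map fun k => (m k).real A)
      (by
        rw [Ultrafilter.coe_map, le_principal_iff]
        exact Filter.mem_map.2 (Eventually.of_forall fun k => hb A k))
  choose L hL hLt using hlim
  refine ⟨⟨fun A => if MeasurableSet A then L A else 0, fun A hA => if_neg hA, ?_, C, ?_⟩, ?_⟩
  · intro A B hA hB h
    rw [if_pos hA, if_pos hB, if_pos (hA.union hB)]
    refine tendsto_nhds_unique (hLt (A ∪ B)) (((hLt A).add (hLt B)).congr fun k => ?_)
    rw [measureReal_union h hB]
  · intro A
    split_ifs
    · rw [abs_of_nonneg (hL A).1]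
      exact (hL A).2
    · simpa using (hL A).1.trans (hL A).2
  · intro A hA
    change Tendsto _ _ (𝓝 (if MeasurableSet A then L A else 0))
    rw [if_pos hA]
    exact hLt A

theorem tendsto_simpleIntegral {U : Filter ℕ} {m : ℕ → Measure X} [∀ k, IsFiniteMeasure (m k)]
    {μ : BoundedCharge X}
    (h : ∀ A, MeasurableSet A → Tendsto (fun k => (m k).real A) U (𝓝 (μ A)))
    (s : SimpleFunc X ℝ) :
    Tendsto (fun k => ∫ x, s x ∂m k) U (𝓝 (simpleIntegral μ s)) := by
  have h1 : ∀ k, ∫ x, s x ∂m k = ∑ c ∈ s.range, c * (m k).real (s ⁻¹' {c}) := by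
    intro k
    rw [← SimpleFunc.integral_eq_integral s (SimpleFunc.integrable_of_isFiniteMeasure s),
      SimpleFunc.integral_eq]
    exact Finset.sum_congr rfl fun c _ => by rw [smul_eq_mul, mul_comm]
  simp_rw [h1]
  exact tendsto_finsetSum _ fun c _ => (h _ (s.measurableSet_fiber c)).const_mul c

theorem simpleIntegral_sub (μ ν : BoundedCharge X) (s : SimpleFunc X ℝ) :
    simpleIntegral (μ - ν) s = simpleIntegral μ s - simpleIntegral ν s := by
  simp only [simpleIntegral, sub_apply, mul_sub, Finset.sum_sub_distrib]

theorem sum_fiber_eq (μ : BoundedCharge X) (s : SimpleFunc X ℝ) :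
    ∑ c ∈ s.range, μ (s ⁻¹' {c}) = μ univ := by
  have key : ∀ T : Finset ℝ, ∑ c ∈ T, μ (s ⁻¹' {c}) = μ (s ⁻¹' (T : Set ℝ)) := by
    classical
    intro T
    induction T using Finset.induction_on with
    | empty => simp [μ.apply_empty]
    | insert a T ha ih =>
      rw [Finset.sum_insert ha, ih, Finset.coe_insert, insert_eq, preimage_union,
        μ.union' _ _ (s.measurableSet_preimage _) (s.measurableSet_preimage _)]
      exact Disjoint.preimage _ (by simpa using ha)
  rw [key, SimpleFunc.coe_range, preimage_range]

theorem simpleIntegral_nonneg {μ : BoundedCharge X} (hμ : 0 ≤ μ) {s : SimpleFunc X ℝ}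
    (hs : ∀ x, 0 ≤ s x) : 0 ≤ simpleIntegral μ s := by
  refine Finset.sum_nonneg fun c hc => mul_nonneg ?_ (hμ _ (s.measurableSet_fiber c))
  obtain ⟨x, rfl⟩ := SimpleFunc.mem_range.1 hc
  exact hs x

theorem simpleIntegral_le {μ : BoundedCharge X} (hμ : 0 ≤ μ) {s : SimpleFunc X ℝ} {C : ℝ}
    (hs : ∀ x, s x ≤ C) : simpleIntegral μ s ≤ C * μ univ := by
  rw [← sum_fiber_eq μ s, Finset.mul_sum]
  refine Finset.sum_le_sum fun c hc =>
    mul_le_mul_of_nonneg_right ?_ (hμ _ (s.measurableSet_fiber c))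
  obtain ⟨x, rfl⟩ := SimpleFunc.mem_range.1 hc
  exact hs x

theorem outer_empty {ν : BoundedCharge X} (hν : 0 ≤ ν) : outer ν ∅ = 0 := by
  refine IsLeast.csInf_eq ⟨⟨∅, .empty, Subset.rfl, ν.apply_empty⟩, ?_⟩
  rintro _ ⟨A, hA, -, rfl⟩
  exact hν A hA

/-- A bounded measurable function is a uniform limit of simple functions. -/
theorem exists_simpleFunc_abs_sub_le {f : X → ℝ} (hf : Measurable f) {C : ℝ}
    (hC : ∀ x, |f x| ≤ C) {ε : ℝ} (hε : 0 < ε) :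
    ∃ s : SimpleFunc X ℝ, ∀ x, |s x - f x| ≤ ε := by
  -- Rounding down to a multiple of `ε` costs at most `ε`, and boundedness leaves finitely many
  -- values.
  have hm : Measurable fun x => ⌊f x / ε⌋ := (hf.div_const ε).floor
  have hfin : (range fun x => ⌊f x / ε⌋).Finite := by
    refine (finite_Icc ⌊-C / ε⌋ ⌊C / ε⌋).subset ?_
    rintro _ ⟨x, rfl⟩
    have := abs_le.1 (hC x)
    exact ⟨Int.floor_mono (by gcongr; exact this.1), Int.floor_mono (by gcongr; exact this.2)⟩
  let t : SimpleFunc X ℤ := ⟨fun x => ⌊f x / ε⌋, fun c => hm (measurableSet_singleton c), hfin⟩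
  refine ⟨t.map fun z : ℤ => (z : ℝ) * ε, fun x => ?_⟩
  change |(⌊f x / ε⌋ : ℝ) * ε - f x| ≤ ε
  have h1 := (le_div_iff₀ hε).1 (Int.floor_le (f x / ε))
  have h2 := (div_lt_iff₀ hε).1 (Int.lt_floor_add_one (f x / ε))
  rw [abs_le]
  constructor <;> linarith

/-- A bounded measurable function is integrable, and its integral is determined by
the integrals of uniformly close simple functions. -/
theorem hasIntegral_of_simpleIntegral_bound {μ : BoundedCharge X} {f : X → ℝ}
    (hf : Measurable f) {C : ℝ} (hC : ∀ x, |f x| ≤ C) {I D : ℝ}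
    (hI : ∀ (s : SimpleFunc X ℝ) (ε : ℝ), (∀ x, |s x - f x| ≤ ε) →
      |simpleIntegral μ s - I| ≤ D * ε) :
    HasIntegral μ f I := by
  have hpos : ∀ k : ℕ, (0 : ℝ) < 1 / ((k : ℝ) + 1) := fun k => Nat.one_div_pos_of_nat
  choose s hs using fun k : ℕ => exists_simpleFunc_abs_sub_le hf hC (hpos k)
  have hlim : Tendsto (fun k : ℕ => 1 / ((k : ℝ) + 1)) atTop (𝓝 0) :=
    tendsto_one_div_add_atTop_nhds_zero_nat
  refine ⟨s, fun ε hε => ?_, ?_, ?_⟩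
  · refine tendsto_const_nhds.congr' ?_
    filter_upwards [hlim.eventually_lt_const hε] with k hk
    have : {x | ε < |s k x - f x|} = ∅ :=
      eq_empty_of_forall_notMem fun x hx => (hx.trans_le (hs k x)).not_ge hk.le
    rw [this, outer_empty (abs_nonneg μ)]
  · have h2 : Tendsto (fun p : ℕ × ℕ => (1 / ((p.1 : ℝ) + 1) + 1 / ((p.2 : ℝ) + 1)) * |μ| univ)
        atTop (𝓝 0) := by
      rw [← prod_atTop_atTop_eq]
      simpa using ((hlim.comp tendsto_fst).add (hlim.comp tendsto_snd)).mul_const (|μ| univ)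
    refine tendsto_of_tendsto_of_tendsto_of_le_of_le tendsto_const_nhds h2 (fun p => ?_)
      fun p => ?_
    · exact simpleIntegral_nonneg (abs_nonneg μ) fun x => abs_nonneg _
    · refine simpleIntegral_le (abs_nonneg μ) fun x => ?_
      change |s p.1 x - s p.2 x| ≤ _
      refine (abs_sub_le _ (f x) _).trans (add_le_add (hs _ x) ?_)
      rw [abs_sub_comm]
      exact hs _ x
  · rw [tendsto_iff_dist_tendsto_zero]
    refine squeeze_zero (fun _ => dist_nonneg) (fun k => ?_) 
      (by simpa only [mul_zero] using hlim.const_mul D)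
    exact hI (s k) _ (hs k)

/-! ### A criterion for purity -/

/-- A σ-additive charge is dominated by a finite measure. -/
theorem exists_abs_le_ofMeasure {ν : BoundedCharge X} (hν : ν ∈ ca X) :
    ∃ (m : Measure X) (_ : IsFiniteMeasure m), |ν| ≤ ofMeasure m := by
  let τ : SignedMeasure X :=
    { measureOf' := ν
      empty' := ν.apply_empty
      not_measurable' := fun A hA => ν.not_measurable' A hA
      m_iUnion' := fun f hf hd => hν f hf hd }
  refine ⟨τ.totalVariation, inferInstance, abs_le'.2 ⟨fun A hA => ?_, fun A hA => ?_⟩⟩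
  · rw [ofMeasure_apply _ hA]
    exact (le_abs_self _).trans (τ.norm_le_totalVariation A)
  · rw [ofMeasure_apply _ hA]
    exact (neg_le_abs _).trans (τ.norm_le_totalVariation A)

/-- A charge is pure if it is concentrated on each member of a sequence of measurable sets that
decreases to the empty set. -/
theorem isPure_of_antitone {μ : BoundedCharge X} {V : ℕ → Set X} (hV : ∀ k, MeasurableSet (V k))
    (hanti : Antitone V) (hinter : ⋂ k, V k = ∅) (h : ∀ k, |μ| (V k)ᶜ ≤ 0) : IsPure μ := by
  intro ν hν
  obtain ⟨m, _, hm⟩ := exists_abs_le_ofMeasure hν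
  have h0 : 0 ≤ |μ| ⊓ |ν| := le_inf (abs_nonneg μ) (abs_nonneg ν)
  refine le_antisymm (fun A hA => ?_) h0
  -- Continuity from above, the only use of σ-additivity: the infimum is at most `m` on `V k` and at
  -- most `|μ|`, that is zero, off it.
  have hlim : Tendsto (fun k => m.real (V k)) atTop (𝓝 0) := by
    have := tendsto_measure_iInter_atTop (μ := m) (fun k => (hV k).nullMeasurableSet) hanti
      ⟨0, measure_ne_top m _⟩
    rw [hinter, measure_empty] at this
    exact (ENNReal.tendsto_toReal ENNReal.zero_ne_top).comp this
  refine ge_of_tendsto' hlim fun k => ?_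
  have h1 := (|μ| ⊓ |ν|).union' (V k) (V k)ᶜ (hV k) (hV k).compl disjoint_compl_right
  rw [union_compl_self] at h1
  have h2 := mono_of_nonneg h0 hA .univ (subset_univ A)
  have h3 : (|μ| ⊓ |ν|) (V k) ≤ m.real (V k) := by
    rw [← ofMeasure_apply m (hV k)]
    exact (inf_le_right.trans hm) _ (hV k)
  have h4 : (|μ| ⊓ |ν|) (V k)ᶜ ≤ |μ| (V k)ᶜ :=
    (inf_le_left : |μ| ⊓ |ν| ≤ |μ|) _ (hV k).compl
  have := h k
  change (|μ| ⊓ |ν|) A ≤ _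
  linarith

end BoundedCharge

/-! ### Averages over small balls and their limit -/

namespace BoundedCharge
open ProbabilityTheory

section Averages

variable {E : Type*} [PseudoMetricSpace E] [SecondCountableTopology E] [MeasurableSpace E]
  [BorelSpace E] {Ω F : Set E}

/-- The kernel that maps `x` to the normalized restriction of `m` to the ball of radius `r`
around `x`. -/
noncomputable def ballAverage (m : Measure Ω) [IsFiniteMeasure m] (F : Set E) (r : ℝ) :
    Kernel F Ω where
  toFun x := m[|(Subtype.val ⁻¹' Metric.ball (x : E) r : Set Ω)]
  measurable' := by
    refine Measure.measurable_of_measurable_coe _ fun A hA => ?_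
    have hB : ∀ x : F, MeasurableSet (Subtype.val ⁻¹' Metric.ball (x : E) r : Set Ω) := fun x =>
      measurable_subtype_coe measurableSet_ball
    have key : ∀ A : Set Ω, MeasurableSet A → Measurable fun x : F =>
        m ((Subtype.val ⁻¹' Metric.ball (x : E) r : Set Ω) ∩ A) := by
      intro A hA
      -- The balls are the sections of one measurable set in the product, so their measure depends
      -- measurably on the centre.
      have hS : MeasurableSet {p : F × Ω | dist (p.2 : E) (p.1 : E) < r ∧ p.2 ∈ A} :=
        MeasurableSet.inter (s₁ := {p : F × Ω | dist (p.2 : E) (p.1 : E) < r})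
          (measurableSet_lt (by fun_prop) measurable_const) (measurable_snd hA)
      exact measurable_measure_prodMk_left hS
    simp_rw [cond_apply (hB _)]
    have h1 := key univ .univ
    simp only [inter_univ] at h1
    exact h1.inv.mul (key A hA)

variable (m : Measure Ω) [IsFiniteMeasure m]

theorem ballAverage_apply (r : ℝ) (x : F) :
    ballAverage m F r x = m[|(Subtype.val ⁻¹' Metric.ball (x : E) r : Set Ω)] := rfl

theorem isMarkovKernel_ballAverage {r : ℝ}
    (h : ∀ x ∈ F, m (Subtype.val ⁻¹' Metric.ball x r : Set Ω) ≠ 0) :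
    IsMarkovKernel (ballAverage m F r) :=
  ⟨fun x => cond_isProbabilityMeasure (h x x.2)⟩

theorem ae_ballAverage_mem_ball (r : ℝ) (x : F) :
    ∀ᵐ y : Ω ∂ballAverage m F r x, (y : E) ∈ Metric.ball (x : E) r := by
  rw [ballAverage_apply]
  exact ae_cond_mem (measurable_subtype_coe measurableSet_ball)

/-- The average is a probability measure carried by the ball, so `ε` for replacing `φ` by `s` and
`η` for the oscillation of `φ` simply add up. -/
theorem abs_integral_ballAverage_sub_le {r : ℝ}
    (h : ∀ x ∈ F, m (Subtype.val ⁻¹' Metric.ball x r : Set Ω) ≠ 0) {φ : E → ℝ} (x : F)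
    (s : SimpleFunc Ω ℝ) {ε η : ℝ} (hs : ∀ y : Ω, |s y - φ y| ≤ ε)
    (hφ : ∀ y : Ω, (y : E) ∈ Metric.ball (x : E) r → |φ y - φ x| ≤ η) :
    |∫ y, s y ∂ballAverage m F r x - φ x| ≤ ε + η := by
  have := isMarkovKernel_ballAverage m h
  have h1 : ∫ y, s y ∂ballAverage m F r x - φ x = ∫ y, (s y - φ x) ∂ballAverage m F r x := by
    rw [integral_sub (SimpleFunc.integrable_of_isFiniteMeasure s) (integrable_const _)]
    simp
  rw [h1]
  have h2 := norm_integral_le_of_norm_le_const (μ := ballAverage m F r x)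
    (f := fun y => s y - φ x) (C := ε + η) (by
      filter_upwards [ae_ballAverage_mem_ball m r x] with y hy
      exact (abs_sub_le _ (φ y) _).trans (add_le_add (hs y) (hφ y hy)))
  simpa using h2

/-- For `x ∈ K` the average at `x` gives `U` full mass 1; integrating this over `K` suffices. -/
theorem real_le_comp_ballAverage {r : ℝ}
    (h : ∀ x ∈ F, m (Subtype.val ⁻¹' Metric.ball x r : Set Ω) ≠ 0)
    (ν : Measure F) [IsFiniteMeasure ν] {K : Set F} (hK : MeasurableSet K) {U : Set E}
    (hU : MeasurableSet U) (hKU : ∀ x ∈ K, Metric.ball (x : E) r ⊆ U) :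
    ν.real K ≤ (ballAverage m F r ∘ₘ ν).real (Subtype.val ⁻¹' U) := by
  have := isMarkovKernel_ballAverage m h
  have hU' : MeasurableSet (Subtype.val ⁻¹' U : Set Ω) := measurable_subtype_coe hU
  refine ENNReal.toReal_mono (measure_ne_top _ _) ?_
  rw [Measure.bind_apply hU' (Kernel.aemeasurable _)]
  calc ν K = ∫⁻ x in K, 1 ∂ν := by simp
    _ ≤ ∫⁻ x in K, ballAverage m F r x (Subtype.val ⁻¹' U) ∂ν := by
      refine setLIntegral_mono' hK fun x hx => ?_
      have h1 : ∀ᵐ y ∂ballAverage m F r x, y ∈ (Subtype.val ⁻¹' U : Set Ω) := by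
        filter_upwards [ae_ballAverage_mem_ball m r x] with y hy using hKU x hx hy
      rw [(prob_compl_eq_zero_iff hU').1 h1]
    _ ≤ _ := setLIntegral_le_lintegral _ _

/-- A finite measure on a part of the boundary of `Ω` that `m` charges everywhere is represented
by a charge on `Ω` that vanishes on `m`-null sets. -/
theorem exists_charge_of_measure [ProperSpace E] (hΩ : Bornology.IsBounded Ω)
    (hFΩ : F ⊆ closure Ω)
    (hpos : ∀ x ∈ F, ∀ δ : ℝ, 0 < δ → m (Subtype.val ⁻¹' Metric.ball x δ : Set Ω) ≠ 0)
    (ν : Measure F) [IsFiniteMeasure ν] :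
    ∃ P : BoundedCharge Ω, 0 ≤ P ∧ P univ = ν.real univ ∧ P ∈ baW m ∧
      (∀ (K : Set F) (U : Set E) (δ : ℝ), 0 < δ → MeasurableSet K → MeasurableSet U →
        (∀ x ∈ K, Metric.ball (x : E) δ ⊆ U) → ν.real K ≤ P (Subtype.val ⁻¹' U)) ∧
      (∀ φ : E → ℝ, ContinuousOn φ (closure Ω) → ∀ (s : SimpleFunc Ω ℝ) (ε : ℝ),
        (∀ x : Ω, |s x - φ x| ≤ ε) →
        |simpleIntegral P s - ∫ y : F, φ y ∂ν| ≤ ν.real univ * ε) := by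
  let r : ℕ → ℝ := fun k => 1 / ((k : ℝ) + 1)
  have hr : ∀ k, 0 < r k := fun k => Nat.one_div_pos_of_nat
  have hrlim : Tendsto r atTop (𝓝 0) := tendsto_one_div_add_atTop_nhds_zero_nat
  have hne : ∀ k, ∀ x ∈ F, m (Subtype.val ⁻¹' Metric.ball x (r k) : Set Ω) ≠ 0 := fun k x hx =>
    hpos x hx _ (hr k)
  have hmk : ∀ k, IsMarkovKernel (ballAverage m F (r k)) := fun k =>
    isMarkovKernel_ballAverage m (hne k)
  have huniv : ∀ k, (ballAverage m F (r k) ∘ₘ ν).real univ = ν.real univ := fun k => by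
    simp [measureReal_def, Measure.bind_apply .univ (Kernel.aemeasurable _)]
  let U : Ultrafilter ℕ := Ultrafilter.of atTop
  -- Whatever holds for all small radii therefore survives in the limit.
  have hU : (U : Filter ℕ) ≤ atTop := Ultrafilter.of_le _
  obtain ⟨P, hP⟩ := exists_ultralimit U (fun k => ballAverage m F (r k) ∘ₘ ν) (ν.real univ)
    fun k => (huniv k).le
  refine ⟨P, fun A hA => ge_of_tendsto' (hP A hA) fun k => measureReal_nonneg, ?_, ?_, ?_, ?_⟩
  · refine tendsto_nhds_unique (hP univ .univ) ?_
    simp_rw [huniv]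
    exact tendsto_const_nhds
  · intro A hA hA0
    refine tendsto_nhds_unique (hP A hA) (tendsto_const_nhds.congr fun k => ?_)
    rw [measureReal_def, Measure.bind_apply hA (Kernel.aemeasurable _)]
    have : ∀ x : F, ballAverage m F (r k) x A = 0 := fun x =>
      cond_absolutelyContinuous hA0
    simp [this]
  · intro K V δ hδ hK hV hKV
    refine ge_of_tendsto (hP _ (measurable_subtype_coe hV)) (hU ?_)
    filter_upwards [hrlim.eventually_lt_const hδ] with k hk
    exact real_le_comp_ballAverage m (hne k) ν hK hV fun x hx =>
      (Metric.ball_subset_ball hk.le).trans (hKV x hx)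
  · intro φ hφ s ε hs
    have hcpt : IsCompact (closure Ω) := hΩ.isCompact_closure
    obtain ⟨C, hC⟩ := hcpt.exists_bound_of_continuousOn hφ
    have hφm : Measurable fun y : F => φ y :=
      (continuousOn_iff_continuous_domRestrict.1 (hφ.mono hFΩ)).measurable
    have hφi : Integrable (fun y : F => φ y) ν :=
      Integrable.of_bound hφm.aestronglyMeasurable C (Eventually.of_forall fun y => hC y (hFΩ y.2))
    have huc := hcpt.uniformContinuousOn_of_continuous hφ
    rw [Metric.uniformContinuousOn_iff] at huc
    refine le_of_forall_pos_le_add fun η hη => ?_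
    obtain ⟨η', hη', hηle⟩ : ∃ η' > 0, ν.real univ * (ε + η') ≤ ν.real univ * ε + η := by
      have hν : 0 ≤ ν.real univ := measureReal_nonneg
      -- The `+ 1` covers the case of zero mass.
      refine ⟨η / (ν.real univ + 1), by positivity, ?_⟩
      have : ν.real univ * (η / (ν.real univ + 1)) ≤ η := by
        rw [mul_div_assoc', div_le_iff₀ (by positivity)]
        nlinarith
      linarith
    obtain ⟨δ, hδ, hδφ⟩ := huc η' hη'
    refine le_trans ?_ hηle
    refine le_of_tendsto ((tendsto_simpleIntegral hP s).sub_const _).abs (hU ?_)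
    filter_upwards [hrlim.eventually_lt_const hδ] with k hk
    have hsi : Integrable s (ballAverage m F (r k) ∘ₘ ν) :=
      SimpleFunc.integrable_of_isFiniteMeasure s
    have hsi' := hsi
    -- Viewing `ν` as a constant kernel makes the integral an iterated one, first over the ball
    -- around `x`, then over `x`.
    rw [Measure.comp_eq_comp_const_apply] at hsi' ⊢
    have hsc := hsi'.integral_comp
    rw [Kernel.const_apply] at hsc
    rw [Kernel.integral_comp hsi', Kernel.const_apply, ← integral_sub hsc hφi]
    have := norm_integral_le_of_norm_le_const (μ := ν)
      (f := fun x : F => ∫ y, s y ∂ballAverage m F (r k) x - φ x) (C := ε + η')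
      (Eventually.of_forall fun x => abs_integral_ballAverage_sub_le m (hne k) x s hs
        fun y hy => (hδφ y (subset_closure y.2) x (hFΩ x.2)
          ((Metric.mem_ball.1 hy).trans hk)).le)
    rwa [mul_comm] at this

end Averages
end BoundedCharge

/-! ### Signed measures and the main theorem -/

theorem exists_isCompact_real_lt_add {Y : Type*} [TopologicalSpace Y] [MeasurableSpace Y]
    (m : Measure Y) [IsFiniteMeasure m] [m.InnerRegularCompactLTTop] {A : Set Y}
    (hA : MeasurableSet A) {ε : ℝ} (hε : 0 < ε) :
    ∃ K ⊆ A, IsCompact K ∧ m.real A < m.real K + ε := by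
  obtain ⟨K, hKA, hK, h⟩ := hA.exists_isCompact_lt_add (measure_ne_top m A)
    (ENNReal.ofReal_pos.2 hε).ne'
  refine ⟨K, hKA, hK, ?_⟩
  have h1 := (ENNReal.toReal_lt_toReal (measure_ne_top m A)
    (ENNReal.add_ne_top.2 ⟨measure_ne_top m K, ENNReal.ofReal_ne_top⟩)).2 h
  rwa [ENNReal.toReal_add (measure_ne_top m K) ENNReal.ofReal_ne_top,
    ENNReal.toReal_ofReal hε.le] at h1

theorem mainTheorem12 {n : ℕ} (Ω F : Set (EuclideanSpace ℝ (Fin n)))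
    (hΩ : MeasurableSet Ω) (hΩb : Bornology.IsBounded Ω)
    (hF : IsClosed F) (hFΩ : F ⊆ closure Ω)
    (hpos : ∀ x ∈ F, ∀ δ : ℝ, 0 < δ → 0 < volume (Metric.ball x δ ∩ Ω))
    (σ : SignedMeasure F) :
    ∃ μ ∈ BoundedCharge.baW (volume.comap (Subtype.val : Ω → EuclideanSpace ℝ (Fin n))),
      (∀ φ : EuclideanSpace ℝ (Fin n) → ℝ, ContinuousOn φ (closure Ω) →
        BoundedCharge.HasIntegral μ (fun x : Ω => φ x) (signedIntegral σ fun y : F => φ y)) ∧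
      BoundedCharge.core μ ⊆ F ∧
      |μ| univ = (σ.totalVariation univ).toReal ∧
      (volume (F ∩ Ω) = 0 → BoundedCharge.IsPure μ) := by
  set m : Measure Ω := volume.comap (Subtype.val : Ω → EuclideanSpace ℝ (Fin n)) with hm
  have hmA : ∀ T : Set (EuclideanSpace ℝ (Fin n)),
      m (Subtype.val ⁻¹' T) = volume (T ∩ Ω) := fun T => by
    rw [hm, (MeasurableEmbedding.subtype_coe hΩ).comap_apply, Subtype.image_preimage_coe,
      inter_comm]
  have hmfin : IsFiniteMeasure m := ⟨by
    have := hmA univ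
    rw [preimage_univ, univ_inter] at this
    rw [this]
    exact hΩb.measure_lt_top⟩
  have hpos' : ∀ x ∈ F, ∀ δ : ℝ, 0 < δ → m (Subtype.val ⁻¹' Metric.ball x δ : Set Ω) ≠ 0 :=
    fun x hx δ hδ => by
      rw [hmA]
      exact (hpos x hx δ hδ).ne'
  set p := σ.toJordanDecomposition.posPart with hp
  set q := σ.toJordanDecomposition.negPart with hq
  obtain ⟨P, hP0, hPu, hPm, hPK, hPI⟩ :=
    BoundedCharge.exists_charge_of_measure m hΩb hFΩ hpos' p
  obtain ⟨N, hN0, hNu, hNm, hNK, hNI⟩ :=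
    BoundedCharge.exists_charge_of_measure m hΩb hFΩ hpos' q
  have hM0 : 0 ≤ P + N := add_nonneg hP0 hN0
  have habs : |P - N| ≤ P + N := by
    refine abs_le'.2 ⟨?_, ?_⟩
    · rw [sub_eq_add_neg]
      exact add_le_add_right ((neg_nonpos.2 hN0).trans hN0) P
    · rw [neg_sub, sub_eq_add_neg, add_comm]
      exact add_le_add_left ((neg_nonpos.2 hP0).trans hP0) N
  have hconc : ∀ δ : ℝ, 0 < δ → (P + N) (Subtype.val ⁻¹' Metric.thickening δ F)ᶜ ≤ 0 := by
    intro δ hδ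
    have hT : MeasurableSet (Metric.thickening δ F) := Metric.isOpen_thickening.measurableSet
    have hT' : MeasurableSet (Subtype.val ⁻¹' Metric.thickening δ F : Set Ω) :=
      measurable_subtype_coe hT
    -- The thickening already receives the full mass of `P` and of `N`, so nothing is left for its
    -- complement.
    have h1 := hPK univ _ δ hδ .univ hT fun x _ => Metric.ball_subset_thickening x.2 δ
    have h2 := hNK univ _ δ hδ .univ hT fun x _ => Metric.ball_subset_thickening x.2 δ
    have h3 := (P + N).union' _ _ hT' hT'.compl disjoint_compl_right
    rw [union_compl_self, BoundedCharge.add_apply, BoundedCharge.add_apply P N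
      (Subtype.val ⁻¹' Metric.thickening δ F), hPu, hNu] at h3
    linarith
  refine ⟨P - N, fun A hA hA0 => ?_, fun φ hφ => ?_, fun x hx => ?_, ?_, fun hFnull => ?_⟩
  · rw [BoundedCharge.sub_apply, hPm A hA hA0, hNm A hA hA0, sub_zero]
  · obtain ⟨C, hC⟩ := hΩb.isCompact_closure.exists_bound_of_continuousOn hφ
    refine BoundedCharge.hasIntegral_of_simpleIntegral_bound (C := C)
      (D := p.real univ + q.real univ)
      (continuousOn_iff_continuous_domRestrict.1 (hφ.mono subset_closure)).measurable
      (fun y => hC y (subset_closure y.2)) fun s ε hs => ?_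
    have h1 := hPI φ hφ s ε hs
    have h2 := hNI φ hφ s ε hs
    rw [BoundedCharge.simpleIntegral_sub]
    change |_ - (∫ y : F, φ y ∂p - ∫ y : F, φ y ∂q)| ≤ _
    rw [sub_sub_sub_comm, add_mul]
    exact (abs_sub _ _).trans (add_le_add h1 h2)
  · by_contra hxF
    obtain ⟨δ, hδ, hball⟩ := Metric.isOpen_iff.1 hF.isOpen_compl x hxF
    -- Half the radius, since the ball must miss the `δ / 2`-thickening of `F` and not only `F`.
    have h1 := hx (Metric.ball x (δ / 2)) Metric.isOpen_ball (Metric.mem_ball_self (half_pos hδ))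
    have hB : MeasurableSet (Subtype.val ⁻¹' Metric.ball x (δ / 2) : Set Ω) :=
      measurable_subtype_coe measurableSet_ball
    have hT' : MeasurableSet (Subtype.val ⁻¹' Metric.thickening (δ / 2) F : Set Ω) :=
      measurable_subtype_coe Metric.isOpen_thickening.measurableSet
    have h2 := BoundedCharge.mono_of_nonneg hM0 hB hT'.compl fun y hy hyT => by
      obtain ⟨z, hz, hyz⟩ := Metric.mem_thickening_iff.1 hyT
      refine hball (a := z) ?_ hz
      have h3 : dist (y : EuclideanSpace ℝ (Fin n)) x < δ / 2 := hy
      have h4 := dist_triangle_left z x (y : EuclideanSpace ℝ (Fin n))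
      rw [Metric.mem_ball]
      linarith
    have h3 := habs _ hB
    have h4 := hconc (δ / 2) (half_pos hδ)
    linarith
  · have htv : (σ.totalVariation univ).toReal = p.real univ + q.real univ := by
      rw [SignedMeasure.totalVariation, ← measureReal_def, measureReal_add_apply]
    rw [htv]
    refine le_antisymm ?_ ?_
    · have := habs univ .univ
      rwa [BoundedCharge.add_apply, hPu, hNu] at this
    · obtain ⟨S, hS, hpS, hqS⟩ := σ.toJordanDecomposition.mutuallySingular
      have : CompactSpace F :=
        isCompact_iff_compactSpace.1 (hΩb.isCompact_closure.of_isClosed_subset hF hFΩ)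
      refine le_of_forall_pos_le_add fun ε hε => ?_
      -- `p` lives on `Sᶜ` and `q` on `S`. With disjoint neighbourhoods `U` of `K` and `V` of `L`,
      -- both `P U` and `N V` miss at most `ε / 4` of the total masses, so `P V` and `N U` are at
      -- most `ε / 4`. Hence `(P - N) U - (P - N) V` loses at most four quarters of `ε`.
      obtain ⟨K, hKS, hK, hpK⟩ := exists_isCompact_real_lt_add p hS.compl
        (show 0 < ε / 4 by positivity)
      obtain ⟨L, hLS, hL, hqL⟩ := exists_isCompact_real_lt_add q hS
        (show 0 < ε / 4 by positivity)
      have hpu : p.real univ = p.real Sᶜ := by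
        have := measureReal_add_measureReal_compl (μ := p) hS
        rw [measureReal_def p S, hpS, ENNReal.toReal_zero, zero_add] at this
        exact this.symm
      have hqu : q.real univ = q.real S := by
        have := measureReal_add_measureReal_compl (μ := q) hS
        rw [measureReal_def q Sᶜ, hqS, ENNReal.toReal_zero, add_zero] at this
        exact this.symm
      have hdisj : Disjoint (Subtype.val '' K) (Subtype.val '' L) :=
        (disjoint_image_iff Subtype.val_injective).2
          (disjoint_compl_left.mono hKS hLS)
      obtain ⟨δ, hδ, hT⟩ := hdisj.exists_thickenings (hK.image continuous_subtype_val)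
        (hL.image continuous_subtype_val).isClosed
      set U := Metric.thickening δ (Subtype.val '' K)
      set V := Metric.thickening δ (Subtype.val '' L)
      have hU : MeasurableSet U := Metric.isOpen_thickening.measurableSet
      have hV : MeasurableSet V := Metric.isOpen_thickening.measurableSet
      have hU' : MeasurableSet (Subtype.val ⁻¹' U : Set Ω) := measurable_subtype_coe hU
      have hV' : MeasurableSet (Subtype.val ⁻¹' V : Set Ω) := measurable_subtype_coe hV
      have hUV : Disjoint (Subtype.val ⁻¹' U : Set Ω) (Subtype.val ⁻¹' V) := hT.preimage _
      have hKU := hPK K U δ hδ hK.measurableSet hU fun x hx =>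
        Metric.ball_subset_thickening (mem_image_of_mem _ hx) δ
      have hLV := hNK L V δ hδ hL.measurableSet hV fun x hx =>
        Metric.ball_subset_thickening (mem_image_of_mem _ hx) δ
      have hPle := BoundedCharge.mono_of_nonneg hP0 (hU'.union hV') .univ (subset_univ _)
      have hNle := BoundedCharge.mono_of_nonneg hN0 (hU'.union hV') .univ (subset_univ _)
      have hAle := BoundedCharge.mono_of_nonneg (abs_nonneg (P - N)) (hU'.union hV') .univ
        (subset_univ _)
      rw [BoundedCharge.union' _ _ _ hU' hV' hUV] at hPle hNle hAle
      have h1 := BoundedCharge.apply_le_abs (P - N) hU'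
      have h2 := BoundedCharge.neg_apply_le_abs (P - N) hV'
      rw [BoundedCharge.sub_apply] at h1 h2
      linarith
  · have hT : ∀ k : ℕ, MeasurableSet (Metric.thickening (1 / ((k : ℝ) + 1)) F) := fun k =>
      Metric.isOpen_thickening.measurableSet
    refine BoundedCharge.isPure_of_antitone
      -- The thickenings alone shrink to the closed set `F`; removing `F` makes the intersection
      -- empty and costs no charge, as `F ∩ Ω` is null.
      (V := fun k : ℕ => Subtype.val ⁻¹' (Metric.thickening (1 / ((k : ℝ) + 1)) F \ F))
      (fun k => measurable_subtype_coe ((hT k).diff hF.measurableSet)) ?_ ?_ fun k => ?_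
    · intro k l hkl
      exact preimage_mono (sdiff_subset_sdiff_left
        (Metric.thickening_mono (Nat.one_div_le_one_div hkl) F))
    · refine eq_empty_of_forall_notMem fun y hy => ?_
      rw [mem_iInter] at hy
      obtain ⟨δ, hδ, hball⟩ := Metric.isOpen_iff.1 hF.isOpen_compl y (hy 0).2
      obtain ⟨k, hk⟩ := exists_nat_one_div_lt hδ
      obtain ⟨z, hz, hyz⟩ := Metric.mem_thickening_iff.1 (hy k).1
      exact hball (Metric.mem_ball'.2 (hyz.trans hk)) hz
    · have hF' : MeasurableSet (Subtype.val ⁻¹' F : Set Ω) :=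
        measurable_subtype_coe hF.measurableSet
      have hT' := measurable_subtype_coe (p := (· ∈ Ω)) (hT k)
      have hδ : (0 : ℝ) < 1 / ((k : ℝ) + 1) := Nat.one_div_pos_of_nat
      have hFT : Disjoint (Subtype.val ⁻¹' Metric.thickening (1 / ((k : ℝ) + 1)) F : Set Ω)ᶜ
          (Subtype.val ⁻¹' F) :=
        disjoint_compl_left.mono_right (preimage_mono (Metric.self_subset_thickening hδ F))
      have hset : (Subtype.val ⁻¹' (Metric.thickening (1 / ((k : ℝ) + 1)) F \ F) : Set Ω)ᶜ =
          (Subtype.val ⁻¹' Metric.thickening (1 / ((k : ℝ) + 1)) F)ᶜ ∪ Subtype.val ⁻¹' F := by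
        rw [preimage_sdiff, Set.sdiff_eq, compl_inter, compl_compl]
      have hnull : m (Subtype.val ⁻¹' F) = 0 := by rw [hmA, hFnull]
      rw [hset]
      refine (habs _ (hT'.compl.union hF')).trans ?_
      have h1 := (P + N).union' _ _ hT'.compl hF' hFT
      have h2 : (P + N) (Subtype.val ⁻¹' F) = 0 := by
        rw [BoundedCharge.add_apply, hPm _ hF' hnull, hNm _ hF' hnull, add_zero]
      have h3 := hconc _ hδ
      linarith
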